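/- Let $d\ge 1$, let $\underline\alpha,\overline\alpha\in(0,2)$, $\underline c\in(0,1]$ and $\overline C\in[1,\infty)$. There is a constant $C=C(d,\underline\alpha,\underline c,\overline\alpha,\overline C)>0$ with the following property. Let $(p_t)_{t\ge 0}$ be the one-dimensional distributions of a pure-jump isotropic unimodal Lévy process in $\mathbb R^d$ with nonzero Lévy measure $\nu$. That is, $\nu\neq 0$ is a measure on $\mathbb R^d$ with $\nu(\{0\})=0$ and $\int (|x|^2\wedge 1)\,\nu(dx)<\infty$, and $(p_t)_{t\ge0}$ is a vaguely continuous convolution semigroup of probability measures on $\mathbb R^d$ with $p_0=\delta_0$ such that every $p_t$ has, on $\mathbb R^d\setminus\{0\}$, a finite radial nonincreasing density with respect to the Lebesgue measure, and $$\int_{\mathbb R^d} e^{i\langle \xi,x\rangle}\,p_t(dx)=e^{-t\psi(\xi)},\qquad \psi(\xi)=\int_{\mathbb R^d}\bigl(1-\cos\langle\xi,x\rangle\bigr)\,\nu(dx),\qquad t\ge 0,\ \xi\in\mathbb R^d .$$ The function $\psi$ is radial; write $\psi(u)=\psi(\xi)$ for $u=|\xi|$. Suppose that $\psi$ satisfies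 the global weak lower and upper scaling conditions $$\underline c\,\lambda^{\underline\alpha}\,\psi(\theta)\ \le\ \psi(\lambda\theta)\ \le\ \overline C\,\lambda^{\overline\alpha}\,\psi(\theta)\qquad\text{for all }\lambda\ge 1,\ \theta>0 .$$ Then for every $t>0$ the measure $p_t$ is absolutely continuous on $\mathbb R^d$ with a (unique, nonnegative) continuous density, denoted $p_t(x)$, and for all $t>0$ and $x\in\mathbb R^d$, $$C^{-1}p_t(2x)\le p_t(x)\le C\,p_t(2x)\qquad\text{and}\qquad C^{-1}p_{2t}(x)\le p_t(x)\le C\,p_{2t}(x).$$ -/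

import Mathlib

open MeasureTheory Set
open scoped NNReal ENNReal

/-- A measure on `ℝᵈ` is isotropic unimodal if on `ℝᵈ \ {0}` it is absolutely continuous with a
finite radial nonincreasing density (an atom at the origin is allowed). -/
def IsIsotropicUnimodal {d : ℕ} (μ : Measure (EuclideanSpace ℝ (Fin d))) : Prop :=
  ∃ f : ℝ → ℝ≥0, AntitoneOn f (Ioi 0) ∧
    μ.restrict {0}ᶜ = volume.withDensity (fun x => (f ‖x‖ : ℝ≥0∞))

/-- Lévy measures: concentrated on `ℝᵈ \ {0}` and integrating `|x|² ∧ 1`. -/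
def IsLevyMeasure {d : ℕ} (ν : Measure (EuclideanSpace ℝ (Fin d))) : Prop :=
  ν {0} = 0 ∧ ∫⁻ x, ENNReal.ofReal (min (‖x‖ ^ 2) 1) ∂ν < ∞

/-- The (pure-jump, symmetric) Lévy–Khintchine exponent
`ψ(ξ) = ∫ (1 - cos ⟨ξ, x⟩) ν(dx)`. -/
noncomputable def levyExponent {d : ℕ} (ν : Measure (EuclideanSpace ℝ (Fin d)))
    (ξ : EuclideanSpace ℝ (Fin d)) : ℝ :=
  ∫ x, (1 - Real.cos (inner ℝ ξ x)) ∂ν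

/-- The profile `u ↦ φ(u e₁)` of a (radial) function `φ` on `ℝᵈ`, `d ≥ 1`;
for radial `φ` and `u ≥ 0` this is the common value of `φ` on the sphere `|ξ| = u`. -/
noncomputable def radialProfile {d : ℕ} [NeZero d] (φ : EuclideanSpace ℝ (Fin d) → ℝ) (u : ℝ) : ℝ :=
  φ (EuclideanSpace.single 0 u)

/-- `φ ∈ WLSC(α, θ₀, c)`: weak lower scaling, for arguments larger than `θ₀`.
The scaling is global if `θ₀ = 0`. -/
def WLSC (φ : ℝ → ℝ) (α θ₀ c : ℝ) : Prop :=
  0 ≤ θ₀ ∧ 0 < c ∧ c ≤ 1 ∧ ∀ l θ : ℝ, 1 ≤ l → θ₀ < θ → c * l ^ α * φ θ ≤ φ (l * θ)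

/-- `φ ∈ WUSC(α, θ₀, C)`: weak upper scaling, for arguments larger than `θ₀`.
The scaling is global if `θ₀ = 0`. -/
def WUSC (φ : ℝ → ℝ) (α θ₀ C : ℝ) : Prop :=
  0 ≤ θ₀ ∧ 1 ≤ C ∧ ∀ l θ : ℝ, 1 ≤ l → θ₀ < θ → φ (l * θ) ≤ C * l ^ α * φ θ

/-- `p = (p_t)_{t ≥ 0}` is the family of one-dimensional distributions of a pure-jump isotropic
unimodal Lévy process in `ℝᵈ` with Lévy measure `ν`: a vaguely continuous convolution semigroup of
isotropic unimodal probability measures whose characteristic functions are `exp(-tψ)`, where `ψ` is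
the exponent of the nonzero Lévy measure `ν`. -/
structure IsUnimodalLevySemigroup {d : ℕ} (p : ℝ≥0 → Measure (EuclideanSpace ℝ (Fin d)))
    (ν : Measure (EuclideanSpace ℝ (Fin d))) : Prop where
  isProbabilityMeasure : ∀ t, IsProbabilityMeasure (p t)
  zero : p 0 = Measure.dirac 0
  add : ∀ s t, p (s + t) = (p s).conv (p t)
  vaguelyContinuous : ∀ f : EuclideanSpace ℝ (Fin d) → ℝ, Continuous f → HasCompactSupport f →
    Continuous (fun t => ∫ x, f x ∂(p t))
  unimodal : ∀ t, IsIsotropicUnimodal (p t)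
  isLevyMeasure : IsLevyMeasure ν
  ne_zero : ν ≠ 0
  charFun_eq : ∀ t ξ, charFun (p t) ξ = (Real.exp (-((t : ℝ) * levyExponent ν ξ)) : ℂ)

/-- `f` is a continuous density of `μ` with respect to the Lebesgue measure on the whole of `ℝᵈ`.
Such an `f` is unique if it exists. -/
def IsContinuousDensity {d : ℕ} (μ : Measure (EuclideanSpace ℝ (Fin d)))
    (f : EuclideanSpace ℝ (Fin d) → ℝ) : Prop :=
  Continuous f ∧ (∀ x, 0 ≤ f x) ∧ μ = volume.withDensity (fun x => ENNReal.ofReal (f x))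

/-- Values `a, b ≥ 0` are comparable with comparability constant `C`: `C⁻¹ a ≤ b ≤ C a`. -/
def ComparableWith (C a b : ℝ) : Prop :=
  0 ≤ a ∧ 0 ≤ b ∧ C⁻¹ * a ≤ b ∧ b ≤ C * a

/-! Fix `t`, put `Φ = tψ` and choose `r` with `Φ r` of order one. The density is comparable with `r
^ d` for `|x| ≤ 2K/r` and with `Φ(1/|x|) / |x| ^ d` for `|x| ≥ K/r`, where `K` and the comparability
constants depend only on `d` and the scaling parameters (`exists_density_estimate`). By scaling,
both expressions change by at most a bounded factor when `x` or `t` is doubled, which gives the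
theorem.

Weak lower scaling makes the characteristic function decay like a stretched exponential. Fourier
inversion then gives a continuous density, and dilation by `r` gives the bound `C r ^ d`
(`exists_isContinuousDensity_le`).

Away from the origin, unimodality converts masses of annuli into pointwise bounds, so tails `μ {|x|
> R}` must be compared with `Φ(1/R)`. The upper tail bound is the truncation inequality for
characteristic functions (`measureReal_lt_norm_le`). The lower one
(`exists_mul_le_measureReal_lt_norm`) uses `αU < 2`: the contribution of small `|x|` to `∫ (1 -
cos⟨ξ,x⟩) dμ` at a low enough frequency is a small part of the whole, so the tail must supply the
rest. Finally `αL > 0` makes the tail at `MR` a small part of the tail at `R`, so the annulus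
between them keeps enough mass (`exists_le_density`). -/

open Filter Topology FourierTransform

/-! ### Continuous densities of unimodal measures by Fourier inversion -/

section Density

variable {d : ℕ}

/-- A continuous function which is almost everywhere a nonincreasing function of the norm is
nonincreasing in the norm everywhere. -/
theorem le_of_norm_le_of_ae_eq_antitone [NeZero d] {q : EuclideanSpace ℝ (Fin d) → ℝ} {G : ℝ → ℝ}
    (hq : Continuous q) (hG : AntitoneOn G (Ioi 0)) (h : ∀ᵐ x, q x = G ‖x‖)
    {x y : EuclideanSpace ℝ (Fin d)} (hxy : ‖x‖ ≤ ‖y‖) : q y ≤ q x := by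
  have h0 : ∀ᵐ x : EuclideanSpace ℝ (Fin d), x ≠ 0 := by
    simp [ae_iff]
  have hd : Dense {x : EuclideanSpace ℝ (Fin d) | q x = G ‖x‖ ∧ x ≠ 0} :=
    Measure.dense_of_ae (h.and h0)
  -- For strict inequality of norms a violation would persist on an open set of pairs, hence at a
  -- pair of good points. Equal norms are reached by letting `t • y` tend to `y` as `t` decreases to
  -- 1.
  have key : ∀ x y : EuclideanSpace ℝ (Fin d), ‖x‖ < ‖y‖ → q y ≤ q x := by
    intro x y hlt
    by_contra! hc
    have ho : IsOpen {z : EuclideanSpace ℝ (Fin d) × EuclideanSpace ℝ (Fin d) |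
        ‖z.1‖ < ‖z.2‖ ∧ q z.1 < q z.2} :=
      (isOpen_lt (continuous_norm.comp continuous_fst) (continuous_norm.comp continuous_snd)).and
        (isOpen_lt (hq.comp continuous_fst) (hq.comp continuous_snd))
    obtain ⟨z, ⟨hz1, hz2⟩, hz3⟩ := (hd.prod hd).inter_open_nonempty _ ho ⟨(x, y), hlt, hc⟩
    obtain ⟨⟨ha, ha0⟩, hb, hb0⟩ := hz3
    rw [ha, hb] at hz2
    exact absurd (hG (norm_pos_iff.2 ha0) (norm_pos_iff.2 hb0) hz1.le) (not_le.2 hz2)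
  rcases eq_or_ne y 0 with rfl | hy
  · have : x = 0 := by simpa using hxy
    rw [this]
  · have ht : Tendsto (fun t : ℝ => q (t • y)) (𝓝[>] 1) (𝓝 (q ((1 : ℝ) • y))) :=
      ((hq.comp (continuous_id.smul continuous_const)).tendsto 1).mono_left nhdsWithin_le_nhds
    rw [one_smul] at ht
    refine le_of_tendsto ht ?_
    filter_upwards [self_mem_nhdsWithin] with t (ht : 1 < t)
    refine key _ _ (hxy.trans_lt ?_)
    rw [norm_smul, Real.norm_of_nonneg (by linarith)]
    exact lt_mul_of_one_lt_left (norm_pos_iff.2 hy) ht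

theorem IsIsotropicUnimodal.exists_antitone {μ : Measure (EuclideanSpace ℝ (Fin d))} [NeZero d]
    (hμ : IsIsotropicUnimodal μ) : ∃ g : ℝ → ℝ≥0∞, Antitone g ∧ (∀ r, 0 < r → g r ≠ ∞) ∧
      μ.restrict {0}ᶜ = volume.withDensity (fun x => g ‖x‖) := by
  obtain ⟨f, hf, hμf⟩ := hμ
  -- The value `∞` for `r ≤ 0` makes the profile antitone on the whole line, hence measurable with
  -- countably many jumps; the origin is a null set.
  refine ⟨fun r => if r ≤ 0 then ∞ else f r, ?_, ?_, ?_⟩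
  · intro a b hab
    dsimp only
    split_ifs with h1 h2 h2
    · exact le_rfl
    · linarith
    · exact le_top
    · exact ENNReal.coe_le_coe.2 (hf (not_le.1 h2) (not_le.1 h1) hab)
  · intro r hr
    simp [not_le.2 hr]
  · rw [hμf]
    refine withDensity_congr_ae ?_
    have h0 : ∀ᵐ x : EuclideanSpace ℝ (Fin d), x ≠ 0 := by simp [ae_iff]
    filter_upwards [h0] with x hx
    simp [hx]

theorem charFun_eq_of_restrict_compl_eq_withDensity [NeZero d]
    {μ : Measure (EuclideanSpace ℝ (Fin d))} [IsFiniteMeasure μ] {g : ℝ → ℝ≥0∞} (hg : Antitone g)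
    (hgt : ∀ r, 0 < r → g r ≠ ∞)
    (h : μ.restrict {0}ᶜ = volume.withDensity (fun x => g ‖x‖)) (w : EuclideanSpace ℝ (Fin d)) :
    charFun μ (-(2 * Real.pi) • w) =
      μ.real {0} + 𝓕 (fun x : EuclideanSpace ℝ (Fin d) => ((g ‖x‖).toReal : ℂ)) w := by
  have hm : Measurable fun x : EuclideanSpace ℝ (Fin d) => g ‖x‖ := hg.measurable.comp measurable_norm
  have h0 : ∀ᵐ x : EuclideanSpace ℝ (Fin d), x ≠ 0 := by simp [ae_iff]
  have hint : Integrable (fun x : EuclideanSpace ℝ (Fin d) =>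
      Complex.exp (inner ℝ x (-(2 * Real.pi) • w) * Complex.I)) μ := by
    refine Integrable.of_bound (by fun_prop) 1 (ae_of_all _ fun x => ?_)
    rw [Complex.norm_exp_ofReal_mul_I]
  rw [charFun_apply, ← integral_add_compl (measurableSet_singleton 0) hint, h,
    integral_withDensity_eq_integral_toReal_smul hm]
  · congr 1
    · simp [measureReal_def]
    · rw [Real.fourier_eq']
      refine integral_congr_ae (ae_of_all _ fun x => ?_)
      simp only [inner_smul_right, Complex.real_smul, smul_eq_mul]
      rw [mul_comm]
      push_cast
      ring_nf
  · filter_upwards [h0] with x hx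
    exact (hgt _ (norm_pos_iff.2 hx)).lt_top

theorem IsIsotropicUnimodal.exists_isContinuousDensity [NeZero d]
    {μ : Measure (EuclideanSpace ℝ (Fin d))} [IsFiniteMeasure μ] (hμ : IsIsotropicUnimodal μ)
    (hi : Integrable (charFun μ)) (h0 : Tendsto (charFun μ) (cocompact _) (𝓝 0)) :
    ∃ q : EuclideanSpace ℝ (Fin d) → ℝ, IsContinuousDensity μ q ∧
      (∀ x y, ‖x‖ ≤ ‖y‖ → q y ≤ q x) ∧
      ∀ x, q x ≤ ∫ ξ, ‖charFun μ (-(2 * Real.pi) • ξ)‖ := by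
  obtain ⟨g, hg, hgt, hμg⟩ := hμ.exists_antitone
  have hne : ∀ᵐ x : EuclideanSpace ℝ (Fin d), x ≠ 0 := by simp [ae_iff]
  have hm : Measurable fun x : EuclideanSpace ℝ (Fin d) => g ‖x‖ := hg.measurable.comp measurable_norm
  set G : EuclideanSpace ℝ (Fin d) → ℂ := fun x => ((g ‖x‖).toReal : ℂ) with hGdef
  have hchar := charFun_eq_of_restrict_compl_eq_withDensity hg hgt hμg
  have hlint : ∫⁻ x : EuclideanSpace ℝ (Fin d), g ‖x‖ ≠ ∞ := by
    rw [← setLIntegral_univ, ← withDensity_apply _ MeasurableSet.univ, ← hμg]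
    exact measure_ne_top _ _
  have hGi : Integrable G := (integrable_toReal_of_lintegral_ne_top hm.aemeasurable hlint).ofReal
  have hpi : -(2 * Real.pi) ≠ 0 := neg_ne_zero.2 Real.two_pi_pos.ne'
  -- By Riemann–Lebesgue the absolutely continuous part has a transform vanishing at infinity; so
  -- has `μ`, which leaves no room for an atom.
  have hmass : μ {0} = 0 := by
    have h1 : Tendsto (𝓕 G) (cocompact _) (𝓝 0) :=
      tendsto_integral_exp_inner_smul_cocompact G
    have h2 : Tendsto (fun w : EuclideanSpace ℝ (Fin d) => charFun μ (-(2 * Real.pi) • w))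
        (cocompact _) (𝓝 0) :=
      h0.comp (Homeomorph.smulOfNeZero (-(2 * Real.pi)) hpi).isClosedEmbedding.tendsto_cocompact
    have h3 : Tendsto (fun _ : EuclideanSpace ℝ (Fin d) => (μ.real {0} : ℂ)) (cocompact _)
        (𝓝 (0 - 0)) := by
      refine (h2.sub h1).congr fun w => ?_
      rw [hchar w]
      ring
    have h4 := tendsto_nhds_unique h3 tendsto_const_nhds
    simp only [sub_zero] at h4
    have h5 : μ.real {0} = 0 := by exact_mod_cast h4.symm
    exact (measureReal_eq_zero_iff).1 h5
  have hF : 𝓕 G = fun w => charFun μ (-(2 * Real.pi) • w) := by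
    ext w
    rw [hchar w]
    simp [measureReal_def, hmass, hGdef]
  have hFi : Integrable (𝓕 G) := by
    rw [hF]
    exact (integrable_comp_smul_iff volume (charFun μ) hpi).2 hi
  -- A monotone profile has countably many jumps, and each corresponds to a sphere of measure zero.
  -- Pointwise inversion is valid at the other points.
  have hcont : ∀ᵐ x : EuclideanSpace ℝ (Fin d), ContinuousAt G x := by
    have hcnt : {r | ¬ ContinuousAt g r}.Countable := hg.countable_not_continuousAt
    have hnull : volume (⋃ r ∈ {r | ¬ ContinuousAt g r},
        Metric.sphere (0 : EuclideanSpace ℝ (Fin d)) r) = 0 :=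
      (measure_biUnion_null_iff hcnt).2 fun r _ => Measure.addHaar_sphere _ _ _
    have hcg : ∀ᵐ x : EuclideanSpace ℝ (Fin d), ContinuousAt g ‖x‖ := by
      rw [ae_iff]
      refine measure_mono_null (fun x hx => ?_) hnull
      simp only [mem_iUnion]
      exact ⟨‖x‖, hx, by simp⟩
    filter_upwards [hcg, hne] with x hx hx0
    have h1 : ContinuousAt (fun y : EuclideanSpace ℝ (Fin d) => g ‖y‖) x :=
      ContinuousAt.comp (f := fun y : EuclideanSpace ℝ (Fin d) => ‖y‖) hx
        continuous_norm.continuousAt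
    have h2 : ContinuousAt (fun y : EuclideanSpace ℝ (Fin d) => (g ‖y‖).toReal) x :=
      (ENNReal.tendsto_toReal (hgt _ (norm_pos_iff.2 hx0))).comp h1
    exact Complex.continuous_ofReal.continuousAt.comp h2
  have hqc : Continuous (𝓕⁻ (𝓕 G)) := by
    rw [show 𝓕⁻ (𝓕 G) = fun w => 𝓕 (𝓕 G) (-w) from
      funext fun w => Real.fourierInv_eq_fourier_neg _ _]
    exact (VectorFourier.fourierIntegral_continuous Real.continuous_fourierChar
      (L := innerₗ (EuclideanSpace ℝ (Fin d))) continuous_inner hFi).comp continuous_neg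
  set q : EuclideanSpace ℝ (Fin d) → ℝ := fun x => (𝓕⁻ (𝓕 G) x).re with hqdef
  have hq : Continuous q := Complex.continuous_re.comp hqc
  have hqG : ∀ᵐ x, q x = (g ‖x‖).toReal := by
    filter_upwards [hcont] with x hx
    rw [hqdef]
    dsimp only
    rw [hGi.fourierInv_fourier_eq hFi hx, hGdef, Complex.ofReal_re]
  refine ⟨q, ⟨hq, ?_, ?_⟩, fun x y hxy => le_of_norm_le_of_ae_eq_antitone hq
    (G := fun r => (g r).toReal) ?_ hqG hxy, ?_⟩
  · have hd : Dense {x | 0 ≤ q x} := Measure.dense_of_ae (μ := volume) (by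
      filter_upwards [hqG] with x hx
      rw [hx]
      exact ENNReal.toReal_nonneg)
    have hcl : IsClosed {x | 0 ≤ q x} := isClosed_le continuous_const hq
    intro x
    have : x ∈ closure {x | 0 ≤ q x} := hd x
    rwa [hcl.closure_eq] at this
  · have : μ.restrict {0}ᶜ = μ := by
      refine Measure.restrict_eq_self_of_ae_mem ?_
      rw [ae_iff]
      simpa using hmass
    rw [← this, hμg]
    refine withDensity_congr_ae ?_
    filter_upwards [hqG, hne] with x hx hx0
    rw [hx, ENNReal.ofReal_toReal (hgt _ (norm_pos_iff.2 hx0))]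
  · intro a ha b _ hab
    exact ENNReal.toReal_mono (hgt a ha) (hg hab)
  · intro x
    have hn : ‖𝓕⁻ (𝓕 G) x‖ ≤ ∫ v, ‖𝓕 G v‖ := by
      rw [Real.fourierInv_eq]
      refine (norm_integral_le_integral_norm _).trans_eq ?_
      simp
    calc q x ≤ ‖𝓕⁻ (𝓕 G) x‖ := Complex.re_le_norm _
      _ ≤ _ := hn
      _ = _ := by rw [hF]

end Density

/-! ### Rotation invariance -/

section Radial

variable {d : ℕ}

theorem IsIsotropicUnimodal.map_linearIsometryEquiv {μ : Measure (EuclideanSpace ℝ (Fin d))}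
    (hμ : IsIsotropicUnimodal μ)
    (O : EuclideanSpace ℝ (Fin d) ≃ₗᵢ[ℝ] EuclideanSpace ℝ (Fin d)) : μ.map O = μ := by
  obtain ⟨f, -, hμf⟩ := hμ
  have hO : MeasurePreserving O (volume : Measure (EuclideanSpace ℝ (Fin d))) volume :=
    O.measurePreserving
  have hOm : MeasurableEmbedding O := O.toHomeomorph.measurableEmbedding
  have hpre : ∀ s : Set (EuclideanSpace ℝ (Fin d)), MeasurableSet s →
      μ.restrict {0}ᶜ (O ⁻¹' s) = μ.restrict {0}ᶜ s := by
    intro s hs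
    rw [hμf, withDensity_apply _ hs, withDensity_apply _ (O.continuous.measurable hs),
      ← hO.setLIntegral_comp_preimage_emb hOm _ s]
    simp
  ext s hs
  rw [Measure.map_apply O.continuous.measurable hs]
  have h1 : ∀ s : Set (EuclideanSpace ℝ (Fin d)), MeasurableSet s →
      μ s = μ (s ∩ {0}) + μ.restrict {0}ᶜ s := by
    intro s hs
    rw [Measure.restrict_apply hs, ← sdiff_eq, measure_inter_add_sdiff _ (measurableSet_singleton 0)]
  rw [h1 s hs, h1 _ (O.continuous.measurable hs), hpre s hs]
  congr 2
  ext x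
  simp only [mem_inter_iff, mem_preimage, mem_singleton_iff]
  constructor <;> (rintro ⟨h, rfl⟩; simpa using h)

/-- The reflection in the hyperplane orthogonal to `ξ - η` exchanges the two vectors and preserves
`μ`. -/
theorem IsIsotropicUnimodal.charFun_eq_of_norm_eq {μ : Measure (EuclideanSpace ℝ (Fin d))}
    (hμ : IsIsotropicUnimodal μ) {ξ η : EuclideanSpace ℝ (Fin d)} (h : ‖ξ‖ = ‖η‖) :
    charFun μ ξ = charFun μ η := by
  set O := (ℝ ∙ (ξ - η))ᗮ.reflection
  have hO : O ξ = η := Submodule.reflection_sub h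
  have hmap := hμ.map_linearIsometryEquiv O
  rw [← hO, charFun_apply, charFun_apply]
  conv_rhs => rw [← hmap]
  rw [MeasurableEmbedding.integral_map (f := O) O.toHomeomorph.measurableEmbedding]
  simp

end Radial

/-! ### First consequences of weak scaling -/

section Scaling

variable {Φ : ℝ → ℝ} {α c C : ℝ}

theorem WLSC.le_mul (h : WLSC Φ α 0 c) (hα : 0 ≤ α) (hΦ : ∀ θ, 0 < θ → 0 ≤ Φ θ) {u v : ℝ}
    (hu : 0 < u) (huv : u ≤ v) : Φ u ≤ c⁻¹ * Φ v := by
  obtain ⟨-, hc, -, h⟩ := h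
  have h1 := h (v / u) u ((one_le_div hu).2 huv) hu
  rw [div_mul_cancel₀ _ hu.ne'] at h1
  have h2 : (1 : ℝ) ≤ (v / u) ^ α := Real.one_le_rpow ((one_le_div hu).2 huv) hα
  rw [le_inv_mul_iff₀ hc]
  refine le_trans ?_ h1
  have := hΦ u hu
  nlinarith [mul_nonneg hc.le this]

theorem WUSC.map_mul_inv_le (h : WUSC Φ α 0 C) {l R : ℝ} (hl : 1 ≤ l) (hR : 0 < R) :
    Φ (l * R⁻¹) ≤ C * l ^ α * Φ R⁻¹ :=
  h.2.2 l R⁻¹ hl (inv_pos.2 hR)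

end Scaling

/-! ### Tails and truncated second moments in terms of the exponent -/

section Tail

variable {d : ℕ} {μ : Measure (EuclideanSpace ℝ (Fin d))} {Φ : ℝ → ℝ} {αL cL αU CU : ℝ}

theorem setOf_lt_norm_subset_iUnion_inner [NeZero d] {R : ℝ} :
    {x : EuclideanSpace ℝ (Fin d) | R < ‖x‖} ⊆
      ⋃ i : Fin d, {x | R / d < |inner ℝ (EuclideanSpace.single i (1 : ℝ)) x|} := by
  intro x hx
  simp only [mem_ofPred_eq, mem_iUnion] at hx ⊢
  by_contra! h
  have hd : (0 : ℝ) < d := Nat.cast_pos.2 (NeZero.pos d)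
  have h1 : ‖x‖ ≤ ∑ i : Fin d, R / d := by
    conv_lhs => rw [← (EuclideanSpace.basisFun (Fin d) ℝ).sum_repr x]
    refine (norm_sum_le _ _).trans (Finset.sum_le_sum fun i _ => ?_)
    have := h i
    simpa [norm_smul, EuclideanSpace.inner_single_left] using this
  simp only [Finset.sum_const, Finset.card_univ, Fintype.card_fin, nsmul_eq_mul] at h1
  rw [mul_div_cancel₀ _ hd.ne'] at h1
  linarith

/-- A vector of norm above `R` has a coordinate above `R / d`. Each coordinate is handled by the
truncation inequality, with `1 - exp (-Φ) ≤ Φ` and almost monotonicity bounding the integrand. -/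
theorem measureReal_lt_norm_le [NeZero d] [IsProbabilityMeasure μ]
    (hchar : ∀ ξ, charFun μ ξ = (Real.exp (-Φ ‖ξ‖) : ℂ)) (hΦ : ∀ θ, 0 ≤ Φ θ)
    (hlo : WLSC Φ αL 0 cL) (hup : WUSC Φ αU 0 CU) (hαL : 0 ≤ αL) {R : ℝ} (hR : 0 < R) :
    μ.real {x | R < ‖x‖} ≤ d * (2 * cL⁻¹ * (CU * (2 * d) ^ αU)) * Φ R⁻¹ := by
  have hd1 : (1 : ℝ) ≤ d := Nat.one_le_cast.2 (NeZero.one_le)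
  have hd : (0 : ℝ) < d := by linarith
  have hcL := hlo.2.1
  set r : ℝ := R / d with hr
  have hr0 : 0 < r := by positivity
  have h2r : 2 * r⁻¹ = 2 * d * R⁻¹ := by rw [hr]; field_simp
  have key : ∀ i : Fin d,
      μ.real {x | r < |inner ℝ (EuclideanSpace.single i (1 : ℝ)) x|} ≤
        2 * cL⁻¹ * (CU * (2 * d) ^ αU) * Φ R⁻¹ := by
    intro i
    refine (measureReal_abs_inner_gt_le_integral_charFun hr0).trans ?_
    have hb : ∀ t ∈ uIoc (-2 * r⁻¹) (2 * r⁻¹),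
        ‖1 - charFun μ (t • EuclideanSpace.single i (1 : ℝ))‖ ≤ cL⁻¹ * Φ (2 * r⁻¹) := by
      intro t ht
      have h0 : -2 * r⁻¹ ≤ 2 * r⁻¹ := by have := inv_pos.2 hr0; linarith
      rw [uIoc_of_le h0] at ht
      have hn : ‖t • EuclideanSpace.single i (1 : ℝ)‖ = |t| := by simp [norm_smul]
      rw [hchar, hn]
      -- The scaling conditions concern positive arguments only; at 0 the characteristic function is
      -- 1.
      rcases eq_or_ne t 0 with rfl | htne
      · have h00 := hchar 0
        rw [charFun_zero, norm_zero] at h00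
        rw [abs_zero, ← h00]
        simp only [probReal_univ, Complex.ofReal_one, sub_self, norm_zero]
        exact mul_nonneg (inv_nonneg.2 hcL.le) (hΦ _)
      · rw [← Complex.ofReal_one, ← Complex.ofReal_sub, Complex.norm_real, Real.norm_of_nonneg]
        · have h1 := Real.add_one_le_exp (-Φ |t|)
          have h2 := hlo.le_mul hαL (fun θ _ => hΦ θ) (abs_pos.2 htne)
            (abs_le.2 ⟨by linarith [ht.1], ht.2⟩)
          linarith
        · have := Real.exp_le_one_iff.2 (neg_nonpos.2 (hΦ |t|))
          linarith
    have hI := intervalIntegral.norm_integral_le_of_norm_le_const hb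
    have hw : |2 * r⁻¹ - -2 * r⁻¹| = 4 * r⁻¹ := by
      rw [abs_of_nonneg] <;> [ring; (have := inv_pos.2 hr0; linarith)]
    rw [hw] at hI
    have hU : Φ (2 * r⁻¹) ≤ CU * (2 * d) ^ αU * Φ R⁻¹ := by
      rw [h2r]
      exact hup.map_mul_inv_le (by linarith) hR
    calc _ ≤ 2⁻¹ * r * (cL⁻¹ * Φ (2 * r⁻¹) * (4 * r⁻¹)) := by gcongr
      _ = 2 * cL⁻¹ * Φ (2 * r⁻¹) := by field_simp; ring
      _ ≤ 2 * cL⁻¹ * (CU * (2 * d) ^ αU * Φ R⁻¹) := by gcongr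
      _ = _ := by ring
  calc μ.real {x | R < ‖x‖} ≤ μ.real (⋃ i : Fin d,
        {x | r < |inner ℝ (EuclideanSpace.single i (1 : ℝ)) x|}) :=
        measureReal_mono setOf_lt_norm_subset_iUnion_inner
    _ ≤ ∑ i : Fin d, μ.real {x | r < |inner ℝ (EuclideanSpace.single i (1 : ℝ)) x|} :=
        measureReal_iUnion_fintype_le _
    _ ≤ ∑ i : Fin d, 2 * cL⁻¹ * (CU * (2 * d) ^ αU) * Φ R⁻¹ :=
        Finset.sum_le_sum fun i _ => key i
    _ = _ := by simp; ring

theorem integrable_one_sub_cos_inner [IsFiniteMeasure μ] (ξ : EuclideanSpace ℝ (Fin d)) :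
    Integrable (fun x => 1 - Real.cos (inner ℝ x ξ)) μ := by
  refine Integrable.of_bound (by fun_prop) 2 (ae_of_all _ fun x => ?_)
  rw [Real.norm_eq_abs, abs_le]
  constructor <;> linarith [Real.cos_le_one (inner ℝ x ξ), Real.neg_one_le_cos (inner ℝ x ξ)]

theorem integral_one_sub_cos_inner [IsProbabilityMeasure μ]
    (hchar : ∀ ξ, charFun μ ξ = (Real.exp (-Φ ‖ξ‖) : ℂ)) (ξ : EuclideanSpace ℝ (Fin d)) :
    ∫ x, (1 - Real.cos (inner ℝ x ξ)) ∂μ = 1 - Real.exp (-Φ ‖ξ‖) := by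
  have hi : Integrable (fun x => Complex.exp (inner ℝ x ξ * Complex.I)) μ := by
    refine Integrable.of_bound (by fun_prop) 1 (ae_of_all _ fun x => ?_)
    rw [Complex.norm_exp_ofReal_mul_I]
  have h1 : ∫ x, Real.cos (inner ℝ x ξ) ∂μ = Real.exp (-Φ ‖ξ‖) := by
    have h2 := congrArg Complex.re (hchar ξ)
    rw [charFun_apply, Complex.ofReal_re] at h2
    rw [← h2, ← RCLike.re_eq_complex_re, ← integral_re hi]
    simp [Complex.exp_ofReal_mul_I_re]
  rw [integral_sub (integrable_const _), h1]
  · simp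
  · refine Integrable.of_bound (by fun_prop) 1 (ae_of_all _ fun x => ?_)
    exact Real.abs_cos_le_one _

/-- On the ball the argument `x i / R` lies in `[-π, π]`, where `1 - cos u ≥ 2u²/π²`; summing over
coordinates bounds the moment by `∫ (1 - cos) dμ`. -/
theorem setIntegral_sq_norm_closedBall_le [IsProbabilityMeasure μ]
    (hchar : ∀ ξ, charFun μ ξ = (Real.exp (-Φ ‖ξ‖) : ℂ)) {R : ℝ} (hR : 0 < R) :
    ∫ x in Metric.closedBall 0 R, ‖x‖ ^ 2 ∂μ ≤ Real.pi ^ 2 / 2 * d * R ^ 2 * Φ R⁻¹ := by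
  have hpt : ∀ x ∈ Metric.closedBall (0 : EuclideanSpace ℝ (Fin d)) R,
      ‖x‖ ^ 2 ≤ Real.pi ^ 2 / 2 * R ^ 2 *
        ∑ i : Fin d, (1 - Real.cos (inner ℝ x (EuclideanSpace.single i R⁻¹))) := by
    intro x hx
    rw [mem_closedBall_zero_iff] at hx
    rw [EuclideanSpace.norm_sq_eq, Finset.mul_sum]
    refine Finset.sum_le_sum fun i _ => ?_
    have hxi : |x i| ≤ R := (PiLp.norm_apply_le x i).trans hx
    have hin : inner ℝ x (EuclideanSpace.single i R⁻¹) = x i * R⁻¹ := by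
      simp [EuclideanSpace.inner_single_right, mul_comm]
    have habs : |x i * R⁻¹| ≤ Real.pi := by
      rw [abs_mul, abs_of_pos (inv_pos.2 hR), ← div_eq_mul_inv]
      exact ((div_le_one hR).2 hxi).trans (by linarith [Real.pi_gt_three])
    have hc := Real.cos_le_one_sub_mul_cos_sq habs
    rw [hin, Real.norm_eq_abs, sq_abs]
    calc (x i) ^ 2 = Real.pi ^ 2 / 2 * R ^ 2 * (2 / Real.pi ^ 2 * (x i * R⁻¹) ^ 2) := by
          have := Real.pi_ne_zero
          field_simp
      _ ≤ _ := by gcongr; linarith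
  have hint : Integrable (fun x : EuclideanSpace ℝ (Fin d) => Real.pi ^ 2 / 2 * R ^ 2 *
      ∑ i : Fin d, (1 - Real.cos (inner ℝ x (EuclideanSpace.single i R⁻¹)))) μ :=
    (integrable_finsetSum _ fun i _ => integrable_one_sub_cos_inner _).const_mul _
  calc ∫ x in Metric.closedBall 0 R, ‖x‖ ^ 2 ∂μ
      ≤ ∫ x in Metric.closedBall 0 R, Real.pi ^ 2 / 2 * R ^ 2 *
          ∑ i : Fin d, (1 - Real.cos (inner ℝ x (EuclideanSpace.single i R⁻¹))) ∂μ :=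
        setIntegral_mono_on ((continuous_norm.pow 2).continuousOn.integrableOn_compact
          (isCompact_closedBall 0 R)) hint.integrableOn measurableSet_closedBall hpt
    _ ≤ ∫ x, Real.pi ^ 2 / 2 * R ^ 2 *
          ∑ i : Fin d, (1 - Real.cos (inner ℝ x (EuclideanSpace.single i R⁻¹))) ∂μ := by
        refine setIntegral_le_integral hint (ae_of_all _ fun x => ?_)
        refine mul_nonneg (by positivity) (Finset.sum_nonneg fun i _ => ?_)
        linarith [Real.cos_le_one (inner ℝ x (EuclideanSpace.single i R⁻¹))]
    _ = Real.pi ^ 2 / 2 * R ^ 2 * ∑ i : Fin d, (1 - Real.exp (-Φ R⁻¹)) := by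
        rw [integral_const_mul, integral_finsetSum _ fun i _ => integrable_one_sub_cos_inner _]
        simp_rw [integral_one_sub_cos_inner hchar]
        simp [abs_of_pos hR]
    _ ≤ Real.pi ^ 2 / 2 * R ^ 2 * ∑ i : Fin d, Φ R⁻¹ := by
        gcongr
        have := Real.add_one_le_exp (-Φ R⁻¹)
        linarith
    _ = _ := by simp; ring

/-- The integral of `1 - cos` is split at radius `ρ`, using `1 - cos u ≤ u²/2` inside and `1 - cos u
≤ 2` outside. The frequency `1/R` is independent of `ρ`. -/
theorem one_sub_exp_le_moment_add_tail [NeZero d] [IsProbabilityMeasure μ]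
    (hchar : ∀ ξ, charFun μ ξ = (Real.exp (-Φ ‖ξ‖) : ℂ)) {R ρ : ℝ} (hR : 0 < R) :
    1 - Real.exp (-Φ R⁻¹) ≤
      (∫ x in Metric.closedBall 0 ρ, ‖x‖ ^ 2 ∂μ) / (2 * R ^ 2) + 2 * μ.real {x | ρ < ‖x‖} := by
  set ξ : EuclideanSpace ℝ (Fin d) := EuclideanSpace.single 0 R⁻¹ with hξ
  have hξn : ‖ξ‖ = R⁻¹ := by simp [hξ, abs_of_pos hR]
  have hi := integrable_one_sub_cos_inner (μ := μ) ξ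
  have hcompl : (Metric.closedBall (0 : EuclideanSpace ℝ (Fin d)) ρ)ᶜ = {x | ρ < ‖x‖} := by
    ext x; simp
  rw [← hξn, ← integral_one_sub_cos_inner hchar,
    ← integral_add_compl (measurableSet_closedBall (x := 0) (ε := ρ)) hi, hcompl]
  refine add_le_add ?_ ?_
  · rw [← integral_div]
    refine setIntegral_mono_on hi.integrableOn
      (((continuous_norm.pow 2).div_const _).continuousOn.integrableOn_compact
          (isCompact_closedBall 0 ρ)) measurableSet_closedBall fun x _ => ?_
    have h1 := Real.one_sub_sq_div_two_le_cos (x := inner ℝ x ξ)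
    have h2 : |inner ℝ x ξ| ≤ ‖x‖ * R⁻¹ := hξn ▸ abs_real_inner_le_norm x ξ
    have h3 : (inner ℝ x ξ) ^ 2 ≤ (‖x‖ * R⁻¹) ^ 2 := by
      rw [← sq_abs]
      exact pow_le_pow_left₀ (abs_nonneg _) h2 2
    have h4 : ‖x‖ ^ 2 / (2 * R ^ 2) = (‖x‖ * R⁻¹) ^ 2 / 2 := by field_simp
    rw [h4]
    linarith
  · calc _ ≤ ∫ x in {x : EuclideanSpace ℝ (Fin d) | ρ < ‖x‖}, (2 : ℝ) ∂μ := by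
          refine integral_mono hi.integrableOn (integrable_const _) fun x => ?_
          dsimp only
          linarith [Real.neg_one_le_cos (inner ℝ x ξ)]
      _ = _ := by simp [mul_comm]

end Tail

/-- At frequency `1/(lρ)` the moment over the ball of radius `ρ` contributes at most `B l ^ (αU - 2)
Φ(1/(lρ))`. As `αU < 2`, a large `l` makes this at most a quarter of `Φ(1/(lρ))`, while the whole
integral is at least half of it. -/
theorem exists_mul_le_measureReal_lt_norm (d : ℕ) [NeZero d] {αL cL αU CU : ℝ} (hcL : 0 < cL)
    (hCU : 1 ≤ CU) (hαL : 0 ≤ αL) (hαU : αU < 2) : ∃ c : ℝ, 0 < c ∧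
      ∀ (μ : Measure (EuclideanSpace ℝ (Fin d))) (Φ : ℝ → ℝ), IsProbabilityMeasure μ →
        (∀ ξ, charFun μ ξ = (Real.exp (-Φ ‖ξ‖) : ℂ)) → (∀ θ, 0 ≤ Φ θ) →
        WLSC Φ αL 0 cL → WUSC Φ αU 0 CU → ∀ ρ : ℝ, 0 < ρ → Φ ρ⁻¹ ≤ cL →
        c * Φ ρ⁻¹ ≤ μ.real {x | ρ < ‖x‖} := by
  set B : ℝ := Real.pi ^ 2 / 4 * d * CU with hB
  have hCU0 : 0 < CU := by linarith
  have hB0 : 0 ≤ B := by positivity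
  -- `l` is the factor between the two radii
  set l : ℝ := (1 + 4 * B) ^ (2 - αU)⁻¹ with hl
  have h2α : 0 < 2 - αU := by linarith
  have hl1 : 1 ≤ l := Real.one_le_rpow (by linarith) (inv_nonneg.2 h2α.le)
  have hl0 : 0 < l := by linarith
  have hlpow : l ^ (2 - αU) = 1 + 4 * B := by
    rw [hl, ← Real.rpow_mul (by linarith), inv_mul_cancel₀ h2α.ne', Real.rpow_one]
  refine ⟨8⁻¹ * (CU * l ^ αU)⁻¹, by positivity, ?_⟩
  intro μ Φ _ hchar hΦ hlo hup ρ hρ hle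
  set R : ℝ := l * ρ with hR
  have hR0 : 0 < R := by positivity
  have hRl : ρ⁻¹ = l * R⁻¹ := by rw [hR]; field_simp
  -- The hypothesis `Φ ρ⁻¹ ≤ cL` absorbs the loss `cL⁻¹` in almost monotonicity.
  have hR1 : Φ R⁻¹ ≤ 1 := by
    have h1 : Φ R⁻¹ ≤ cL⁻¹ * Φ ρ⁻¹ := hlo.le_mul hαL (fun θ _ => hΦ θ) (inv_pos.2 hR0) (by
      rw [hRl]; exact le_mul_of_one_le_left (inv_pos.2 hR0).le hl1)
    refine h1.trans ?_
    rw [inv_mul_le_iff₀ hcL, mul_one]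
    exact hle
  have hU : Φ ρ⁻¹ ≤ CU * l ^ αU * Φ R⁻¹ := by
    rw [hRl]
    exact hup.map_mul_inv_le hl1 hR0
  have hm := setIntegral_sq_norm_closedBall_le hchar hρ
  have ht := one_sub_exp_le_moment_add_tail hchar (ρ := ρ) hR0
  have hmom : (∫ x in Metric.closedBall 0 ρ, ‖x‖ ^ 2 ∂μ) / (2 * R ^ 2) ≤ 4⁻¹ * Φ R⁻¹ := by
    calc _ ≤ (Real.pi ^ 2 / 2 * d * ρ ^ 2 * (CU * l ^ αU * Φ R⁻¹)) / (2 * R ^ 2) := by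
          gcongr
          exact hm.trans (by gcongr)
      _ = B * (l ^ αU / l ^ 2) * Φ R⁻¹ := by
          rw [hB, hR]
          field_simp
          ring
      _ = B * (l ^ (2 - αU))⁻¹ * Φ R⁻¹ := by
          rw [Real.rpow_sub hl0, inv_div]
          norm_num
      _ ≤ 4⁻¹ * Φ R⁻¹ := by
          refine mul_le_mul_of_nonneg_right ?_ (hΦ _)
          rw [hlpow, ← div_eq_mul_inv, div_le_iff₀ (by linarith)]
          linarith
  -- For `0 ≤ s ≤ 1`, `exp (-s) ≤ 1 / (1 + s) ≤ 1 - s / 2`.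
  have hexp : Φ R⁻¹ / 2 ≤ 1 - Real.exp (-Φ R⁻¹) := by
    have h0 := hΦ R⁻¹
    have h1 : Real.exp (-Φ R⁻¹) ≤ (1 + Φ R⁻¹)⁻¹ := by
      rw [Real.exp_neg]
      gcongr
      linarith [Real.add_one_le_exp (Φ R⁻¹)]
    have h2 : (1 + Φ R⁻¹)⁻¹ ≤ 1 - Φ R⁻¹ / 2 := by
      rw [inv_le_iff_one_le_mul₀ (by linarith)]
      nlinarith
    linarith
  have hfin : 8⁻¹ * Φ R⁻¹ ≤ μ.real {x | ρ < ‖x‖} := by linarith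
  refine le_trans ?_ hfin
  rw [mul_assoc]
  gcongr
  rwa [inv_mul_le_iff₀ (by positivity)]

/-! ### From masses of annuli to pointwise bounds -/

section Density

variable {d : ℕ} {μ : Measure (EuclideanSpace ℝ (Fin d))} {q : EuclideanSpace ℝ (Fin d) → ℝ}

theorem IsContinuousDensity.measureReal_le (hq : IsContinuousDensity μ q)
    {A : Set (EuclideanSpace ℝ (Fin d))} (hA : MeasurableSet A) (hAv : volume A ≠ ∞) {b : ℝ}
    (hb : 0 ≤ b) (h : ∀ x ∈ A, q x ≤ b) : μ.real A ≤ b * volume.real A := by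
  obtain ⟨-, -, rfl⟩ := hq
  rw [measureReal_def, withDensity_apply _ hA, measureReal_def, ← ENNReal.toReal_ofReal hb,
    ← ENNReal.toReal_mul]
  refine ENNReal.toReal_mono (ENNReal.mul_ne_top ENNReal.ofReal_ne_top hAv) ?_
  rw [← setLIntegral_const]
  exact setLIntegral_mono' hA fun x hx => ENNReal.ofReal_le_ofReal (h x hx)

theorem IsContinuousDensity.le_measureReal [IsFiniteMeasure μ] (hq : IsContinuousDensity μ q)
    {A : Set (EuclideanSpace ℝ (Fin d))} (hA : MeasurableSet A) {b : ℝ}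
    (hb : 0 ≤ b) (h : ∀ x ∈ A, b ≤ q x) : b * volume.real A ≤ μ.real A := by
  have hfin : μ A ≠ ∞ := measure_ne_top _ _
  obtain ⟨-, -, hμ⟩ := hq
  rw [hμ] at hfin ⊢
  rw [measureReal_def, measureReal_def, ← ENNReal.toReal_ofReal hb, ← ENNReal.toReal_mul]
  refine ENNReal.toReal_mono hfin ?_
  rw [← setLIntegral_const, withDensity_apply _ hA]
  exact setLIntegral_mono' hA fun x hx => ENNReal.ofReal_le_ofReal (h x hx)

theorem volume_real_closedBall_zero {r : ℝ} (hr : 0 ≤ r) :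
    volume.real (Metric.closedBall (0 : EuclideanSpace ℝ (Fin d)) r) =
      r ^ d * volume.real (Metric.ball (0 : EuclideanSpace ℝ (Fin d)) 1) := by
  rw [Measure.addHaar_real_closedBall _ _ hr, finrank_euclideanSpace_fin]

theorem volume_real_ball_zero_one_pos :
    0 < volume.real (Metric.ball (0 : EuclideanSpace ℝ (Fin d)) 1) :=
  ENNReal.toReal_pos (Metric.measure_ball_pos _ _ one_pos).ne' measure_ball_lt_top.ne

end Density

/-- Upper heat kernel bound away from the origin. -/
theorem exists_density_le (d : ℕ) [NeZero d] {αL cL αU CU : ℝ} (hcL : 0 < cL)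
    (hCU : 1 ≤ CU) (hαL : 0 ≤ αL) : ∃ C : ℝ, 0 < C ∧
      ∀ (μ : Measure (EuclideanSpace ℝ (Fin d))) (Φ : ℝ → ℝ) (q : EuclideanSpace ℝ (Fin d) → ℝ),
        IsProbabilityMeasure μ → (∀ ξ, charFun μ ξ = (Real.exp (-Φ ‖ξ‖) : ℂ)) →
        (∀ θ, 0 ≤ Φ θ) → WLSC Φ αL 0 cL → WUSC Φ αU 0 CU → IsContinuousDensity μ q →
        (∀ x y, ‖x‖ ≤ ‖y‖ → q y ≤ q x) → ∀ x, x ≠ 0 → q x ≤ C * Φ ‖x‖⁻¹ / ‖x‖ ^ d := by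
  have hd : (0 : ℝ) < d := Nat.cast_pos.2 (NeZero.pos d)
  have hCU0 : 0 < CU := by linarith
  set ω : ℝ := volume.real (Metric.ball (0 : EuclideanSpace ℝ (Fin d)) 1) with hω
  have hω0 : 0 < ω := volume_real_ball_zero_one_pos
  set K : ℝ := d * (2 * cL⁻¹ * (CU * (2 * d) ^ αU)) with hK
  have hK0 : 0 < K := by positivity
  refine ⟨K * (CU * 2 ^ αU) * (2 / ω), by positivity, ?_⟩
  intro μ Φ q _ hchar hΦ hlo hup hq hmono x hx
  set R := ‖x‖ with hR
  have hR0 : 0 < R := norm_pos_iff.2 hx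
  -- On this annulus the density is at least `q x`, and its mass is at most the tail at `R / 2`.
  set A : Set (EuclideanSpace ℝ (Fin d)) := Metric.closedBall 0 R \ Metric.closedBall 0 (R / 2)
  have hA : MeasurableSet A := measurableSet_closedBall.diff measurableSet_closedBall
  have hvol : R ^ d * (ω / 2) ≤ volume.real A := by
    rw [measureReal_sdiff (Metric.closedBall_subset_closedBall (by linarith))
      measurableSet_closedBall measure_closedBall_lt_top.ne, volume_real_closedBall_zero hR0.le,
      volume_real_closedBall_zero (by positivity), div_pow]
    have h2 : (2 : ℝ) ≤ 2 ^ d := by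
      simpa using pow_le_pow_right₀ (one_le_two (α := ℝ)) (NeZero.one_le (n := d))
    have h3 : R ^ d / 2 ^ d ≤ R ^ d / 2 := by gcongr
    calc R ^ d * (ω / 2) = R ^ d * ω - R ^ d / 2 * ω := by ring
      _ ≤ _ := by gcongr
  have h1 : q x * volume.real A ≤ μ.real A :=
    hq.le_measureReal hA (hq.2.1 x) fun y hy => hmono y x (by simpa using hy.1)
  have h2 : μ.real A ≤ μ.real {y | R / 2 < ‖y‖} :=
    measureReal_mono fun y hy => by simpa using hy.2
  have h3 := measureReal_lt_norm_le hchar hΦ hlo hup hαL (half_pos hR0)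
  have h4 : Φ (R / 2)⁻¹ ≤ CU * 2 ^ αU * Φ R⁻¹ := by
    rw [show (R / 2)⁻¹ = 2 * R⁻¹ by field_simp]
    exact hup.map_mul_inv_le one_le_two hR0
  rw [le_div_iff₀ (by positivity)]
  calc q x * R ^ d = q x * (R ^ d * (ω / 2)) * (2 / ω) := by field_simp
    _ ≤ q x * volume.real A * (2 / ω) := by
        gcongr
        exact hq.2.1 x
    _ ≤ K * (CU * 2 ^ αU * Φ R⁻¹) * (2 / ω) := by
        refine mul_le_mul_of_nonneg_right ?_ (by positivity)
        exact (h1.trans h2).trans (h3.trans (mul_le_mul_of_nonneg_left h4 hK0.le))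
    _ = _ := by ring

/-- Lower heat kernel bound away from the origin. -/
theorem exists_le_density (d : ℕ) [NeZero d] {αL cL αU CU : ℝ} (hcL : 0 < cL)
    (hCU : 1 ≤ CU) (hαL : 0 < αL) (hαU : αU < 2) : ∃ c : ℝ, 0 < c ∧
      ∀ (μ : Measure (EuclideanSpace ℝ (Fin d))) (Φ : ℝ → ℝ) (q : EuclideanSpace ℝ (Fin d) → ℝ),
        IsProbabilityMeasure μ → (∀ ξ, charFun μ ξ = (Real.exp (-Φ ‖ξ‖) : ℂ)) →
        (∀ θ, 0 ≤ Φ θ) → WLSC Φ αL 0 cL → WUSC Φ αU 0 CU → IsContinuousDensity μ q →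
        (∀ x y, ‖x‖ ≤ ‖y‖ → q y ≤ q x) → ∀ x, x ≠ 0 → Φ ‖x‖⁻¹ ≤ cL →
        c * Φ ‖x‖⁻¹ / ‖x‖ ^ d ≤ q x := by
  have hd : (0 : ℝ) < d := Nat.cast_pos.2 (NeZero.pos d)
  have hCU0 : 0 < CU := by linarith
  set ω : ℝ := volume.real (Metric.ball (0 : EuclideanSpace ℝ (Fin d)) 1) with hω
  have hω0 : 0 < ω := volume_real_ball_zero_one_pos
  set K : ℝ := d * (2 * cL⁻¹ * (CU * (2 * d) ^ αU)) with hK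
  have hK0 : 0 < K := by positivity
  obtain ⟨a, ha, htail⟩ := exists_mul_le_measureReal_lt_norm d hcL hCU hαL.le hαU
  have hKa : 0 < 2 * K / (cL * a) := by positivity
  -- `M` is the ratio of the radii of the annulus
  set M : ℝ := (1 + 2 * K / (cL * a)) ^ αL⁻¹ with hM
  have hM1 : 1 ≤ M := Real.one_le_rpow (by linarith) (inv_nonneg.2 hαL.le)
  have hM0 : 0 < M := by linarith
  have hMpow : M ^ αL = 1 + 2 * K / (cL * a) := by
    rw [hM, ← Real.rpow_mul (by linarith), inv_mul_cancel₀ hαL.ne', Real.rpow_one]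
  refine ⟨a / 2 / (M ^ d * ω), by positivity, ?_⟩
  intro μ Φ q _ hchar hΦ hlo hup hq hmono x hx hle
  set R := ‖x‖ with hR
  have hR0 : 0 < R := norm_pos_iff.2 hx
  have h1 := htail μ Φ inferInstance hchar hΦ hlo hup R hR0 hle
  have h2 := measureReal_lt_norm_le hchar hΦ hlo hup hαL.le (mul_pos hM0 hR0)
  -- `M` is chosen so that the upper bound for the tail at `M * R` is at most half the lower bound
  -- for the tail at `R`.
  have h3 : K * Φ (M * R)⁻¹ ≤ a / 2 * Φ R⁻¹ := by
    have h4 := hlo.2.2.2 M (M * R)⁻¹ hM1 (by positivity)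
    rw [show M * (M * R)⁻¹ = R⁻¹ by field_simp, hMpow] at h4
    have h5 : K ≤ a / 2 * (cL * (1 + 2 * K / (cL * a))) := by
      have : a / 2 * (cL * (1 + 2 * K / (cL * a))) = a / 2 * cL + K := by field_simp
      rw [this]
      have : 0 < a / 2 * cL := by positivity
      linarith
    calc K * Φ (M * R)⁻¹ ≤ a / 2 * (cL * (1 + 2 * K / (cL * a))) * Φ (M * R)⁻¹ :=
          mul_le_mul_of_nonneg_right h5 (hΦ _)
      _ = a / 2 * (cL * (1 + 2 * K / (cL * a)) * Φ (M * R)⁻¹) := by ring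
      _ ≤ _ := by gcongr
  -- Here the density is at most `q x`, and at least half of the lower tail bound remains as mass.
  set A : Set (EuclideanSpace ℝ (Fin d)) := {y | R < ‖y‖} \ {y | M * R < ‖y‖}
  have hA : MeasurableSet A := (measurableSet_lt measurable_const measurable_norm).diff
    (measurableSet_lt measurable_const measurable_norm)
  have hAsub : A ⊆ Metric.closedBall 0 (M * R) := fun y hy => by simpa using hy.2
  have hvol : volume.real A ≤ (M * R) ^ d * ω := by
    rw [← volume_real_closedBall_zero (by positivity)]
    exact measureReal_mono hAsub measure_closedBall_lt_top.ne
  have h5 : μ.real A ≤ q x * volume.real A :=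
    hq.measureReal_le hA (measure_mono hAsub |>.trans_lt measure_closedBall_lt_top).ne (hq.2.1 x)
      fun y hy => hmono x y (le_of_lt hy.1)
  have h6 : μ.real {y | R < ‖y‖} ≤ μ.real A + μ.real {y | M * R < ‖y‖} := by
    refine (measureReal_mono fun y hy => ?_).trans (measureReal_union_le _ _)
    by_cases h : M * R < ‖y‖
    · exact Or.inr h
    · exact Or.inl ⟨hy, h⟩
  have h7 : a / 2 * Φ R⁻¹ ≤ q x * ((M * R) ^ d * ω) := by
    have := mul_le_mul_of_nonneg_left hvol (hq.2.1 x)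
    linarith
  rw [div_le_iff₀ (by positivity), div_mul_eq_mul_div, div_le_iff₀ (by positivity)]
  refine h7.trans_eq ?_
  rw [mul_pow]
  ring

/-! ### Decay of the characteristic function and the on-diagonal bound -/

section Integrability

variable {d : ℕ} {μ : Measure (EuclideanSpace ℝ (Fin d))} {Φ : ℝ → ℝ} {αL cL : ℝ}

theorem integrable_exp_neg_mul_norm_rpow [NeZero d] {c α : ℝ} (hc : 0 < c) (hα : 0 < α) :
    Integrable (fun x : EuclideanSpace ℝ (Fin d) => Real.exp (-c * ‖x‖ ^ α)) := by
  refine (integrable_fun_norm_addHaar (μ := volume) (E := EuclideanSpace ℝ (Fin d))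
    (f := fun y : ℝ => Real.exp (-c * y ^ α))).2 ?_
  refine (integrableOn_rpow_mul_exp_neg_mul_rpow (s := ((d - 1 : ℕ) : ℝ)) (p := α) (b := c)
    (by have : (0 : ℝ) ≤ ((d - 1 : ℕ) : ℝ) := Nat.cast_nonneg _
        linarith) hα hc).congr_fun (fun y _ => ?_) measurableSet_Ioi
  simp [Real.rpow_natCast]

/-- For `|ξ| ≥ r` this is lower scaling from `r`. For `|ξ| ≤ r` the factor `exp cL` makes the right
side at least 1. -/
theorem norm_charFun_le_exp [IsProbabilityMeasure μ]
    (hchar : ∀ ξ, charFun μ ξ = (Real.exp (-Φ ‖ξ‖) : ℂ)) (hΦ : ∀ θ, 0 ≤ Φ θ)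
    (hlo : WLSC Φ αL 0 cL) (hαL : 0 ≤ αL) {r : ℝ} (hr : 0 < r) (hΦr : 1 ≤ Φ r)
    (ξ : EuclideanSpace ℝ (Fin d)) :
    ‖charFun μ ξ‖ ≤ Real.exp cL * Real.exp (-cL * ‖r⁻¹ • ξ‖ ^ αL) := by
  have hcL := hlo.2.1
  have hn : ‖r⁻¹ • ξ‖ = ‖ξ‖ / r := by
    rw [norm_smul, norm_inv, Real.norm_of_nonneg hr.le]
    ring
  rw [hchar, Complex.norm_real, Real.norm_of_nonneg (Real.exp_nonneg _), ← Real.exp_add, hn]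
  refine Real.exp_le_exp.2 ?_
  rcases le_total r ‖ξ‖ with h | h
  · have h1 := hlo.2.2.2 (‖ξ‖ / r) r ((one_le_div hr).2 h) hr
    rw [div_mul_cancel₀ _ hr.ne'] at h1
    have h2 : cL * (‖ξ‖ / r) ^ αL ≤ cL * (‖ξ‖ / r) ^ αL * Φ r :=
      le_mul_of_one_le_right (by positivity) hΦr
    linarith
  · have h1 : (‖ξ‖ / r) ^ αL ≤ 1 :=
      Real.rpow_le_one (by positivity) ((div_le_one hr).2 h) hαL
    have h2 := hΦ ‖ξ‖
    nlinarith

theorem integrable_charFun_of_wlsc [NeZero d] [IsProbabilityMeasure μ]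
    (hchar : ∀ ξ, charFun μ ξ = (Real.exp (-Φ ‖ξ‖) : ℂ)) (hΦ : ∀ θ, 0 ≤ Φ θ)
    (hlo : WLSC Φ αL 0 cL) (hαL : 0 < αL) {r : ℝ} (hr : 0 < r) (hΦr : 1 ≤ Φ r) :
    Integrable (charFun μ) := by
  refine Integrable.mono' (((integrable_comp_smul_iff volume _ (inv_ne_zero hr.ne')).2
    (integrable_exp_neg_mul_norm_rpow hlo.2.1 hαL)).const_mul (Real.exp cL))
    measurable_charFun.aestronglyMeasurable (ae_of_all _ fun ξ => ?_)
  exact norm_charFun_le_exp hchar hΦ hlo hαL.le hr hΦr ξ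

theorem tendsto_charFun_cocompact_of_wlsc [IsProbabilityMeasure μ]
    (hchar : ∀ ξ, charFun μ ξ = (Real.exp (-Φ ‖ξ‖) : ℂ)) (hΦ : ∀ θ, 0 ≤ Φ θ)
    (hlo : WLSC Φ αL 0 cL) (hαL : 0 < αL) {r : ℝ} (hr : 0 < r) (hΦr : 1 ≤ Φ r) :
    Tendsto (charFun μ) (cocompact _) (𝓝 0) := by
  refine squeeze_zero_norm (norm_charFun_le_exp hchar hΦ hlo hαL.le hr hΦr) ?_
  have h1 : Tendsto (fun ξ : EuclideanSpace ℝ (Fin d) => ‖r⁻¹ • ξ‖) (cocompact _) atTop := by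
    simp_rw [norm_smul]
    exact (tendsto_norm_cocompact_atTop).const_mul_atTop (norm_pos_iff.2 (inv_ne_zero hr.ne'))
  have h2 := ((tendsto_rpow_atTop hαL).comp h1).const_mul_atTop_of_neg (neg_neg_of_pos hlo.2.1)
  simpa using (Real.tendsto_exp_atBot.comp h2).const_mul (Real.exp cL)

end Integrability

/-- Existence of a radially nonincreasing continuous density with the on-diagonal bound. -/
theorem exists_isContinuousDensity_le (d : ℕ) [NeZero d] {αL cL : ℝ} (hcL : 0 < cL)
    (hαL : 0 < αL) : ∃ C : ℝ, 0 < C ∧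
      ∀ (μ : Measure (EuclideanSpace ℝ (Fin d))) (Φ : ℝ → ℝ), IsProbabilityMeasure μ →
        IsIsotropicUnimodal μ → (∀ ξ, charFun μ ξ = (Real.exp (-Φ ‖ξ‖) : ℂ)) →
        (∀ θ, 0 ≤ Φ θ) → WLSC Φ αL 0 cL → (∃ r, 0 < r ∧ 1 ≤ Φ r) →
        ∃ q, IsContinuousDensity μ q ∧ (∀ x y, ‖x‖ ≤ ‖y‖ → q y ≤ q x) ∧
          ∀ r, 0 < r → 1 ≤ Φ r → ∀ x, q x ≤ C * r ^ d := by
  set f : EuclideanSpace ℝ (Fin d) → ℝ := fun ξ => Real.exp (-cL * ‖ξ‖ ^ αL) with hf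
  have hfi : Integrable f := integrable_exp_neg_mul_norm_rpow hcL hαL
  have hI0 : 0 ≤ ∫ ξ, f ξ := integral_nonneg fun ξ => Real.exp_nonneg _
  refine ⟨Real.exp cL * (∫ ξ, f ξ) + 1, by positivity, ?_⟩
  intro μ Φ _ hμ hchar hΦ hlo ⟨r₀, hr₀, hΦr₀⟩
  have hi := integrable_charFun_of_wlsc hchar hΦ hlo hαL hr₀ hΦr₀
  obtain ⟨q, hq, hmono, hle⟩ := hμ.exists_isContinuousDensity hi
    (tendsto_charFun_cocompact_of_wlsc hchar hΦ hlo hαL hr₀ hΦr₀)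
  refine ⟨q, hq, hmono, fun r hr hΦr x => ?_⟩
  -- `a` combines the dilation by `r⁻¹` with the `2π` of the Fourier transform; the Jacobian
  -- produces `r ^ d`.
  set a : ℝ := r⁻¹ * -(2 * Real.pi) with ha
  have ha0 : a ≠ 0 := mul_ne_zero (inv_ne_zero hr.ne') (neg_ne_zero.2 Real.two_pi_pos.ne')
  have hpi : (1 : ℝ) ≤ (2 * Real.pi) ^ d := one_le_pow₀ (by linarith [Real.pi_gt_three])
  have habs : |(a ^ d)⁻¹| ≤ r ^ d := by
    rw [abs_inv, abs_pow, ha, abs_mul, abs_neg, abs_inv, abs_of_pos hr,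
      abs_of_pos Real.two_pi_pos, mul_pow, mul_inv, inv_pow, inv_inv]
    exact mul_le_of_le_one_right (by positivity) (inv_le_one_of_one_le₀ hpi)
  calc q x ≤ ∫ ξ, ‖charFun μ (-(2 * Real.pi) • ξ)‖ := hle x
    _ ≤ ∫ ξ, Real.exp cL * f (a • ξ) := by
        refine integral_mono_of_nonneg (ae_of_all _ fun ξ => norm_nonneg _)
          (((integrable_comp_smul_iff volume _ ha0).2 hfi).const_mul _) (ae_of_all _ fun ξ => ?_)
        have := norm_charFun_le_exp hchar hΦ hlo hαL.le hr hΦr (-(2 * Real.pi) • ξ)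
        rwa [smul_smul] at this
    _ = Real.exp cL * (|(a ^ d)⁻¹| * ∫ ξ, f ξ) := by
        rw [integral_const_mul, Measure.integral_comp_smul, finrank_euclideanSpace_fin,
          smul_eq_mul]
    _ ≤ Real.exp cL * (r ^ d * ∫ ξ, f ξ) := by gcongr
    _ ≤ (Real.exp cL * (∫ ξ, f ξ) + 1) * r ^ d := by
        have : 0 < r ^ d := by positivity
        linarith

/-! ### The Lévy exponent: nondegeneracy, continuity, radiality -/

theorem IsLevyMeasure.integrable_one_sub_cos {d : ℕ} {ν : Measure (EuclideanSpace ℝ (Fin d))}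
    (hν : IsLevyMeasure ν) (ξ : EuclideanSpace ℝ (Fin d)) :
    Integrable (fun x => 1 - Real.cos (inner ℝ ξ x)) ν := by
  have hi : Integrable (fun x : EuclideanSpace ℝ (Fin d) => min (‖x‖ ^ 2) 1) ν := by
    refine ⟨Continuous.aestronglyMeasurable (by fun_prop), ?_⟩
    rw [hasFiniteIntegral_iff_ofReal (ae_of_all _ fun x => by positivity)]
    exact hν.2
  refine (hi.const_mul (‖ξ‖ ^ 2 / 2 + 2)).mono'
    (Continuous.aestronglyMeasurable (by fun_prop)) (ae_of_all _ fun x => ?_)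
  have h1 := Real.one_sub_sq_div_two_le_cos (x := inner ℝ ξ x)
  have h2 : (inner ℝ ξ x) ^ 2 ≤ ‖ξ‖ ^ 2 * ‖x‖ ^ 2 := by
    rw [← sq_abs, ← mul_pow]
    exact pow_le_pow_left₀ (abs_nonneg _) (abs_real_inner_le_norm ξ x) 2
  have h3 := Real.neg_one_le_cos (inner ℝ ξ x)
  rw [Real.norm_of_nonneg (by linarith [Real.cos_le_one (inner ℝ ξ x)])]
  rcases le_total (‖x‖ ^ 2) 1 with h | h
  · rw [min_eq_left h]
    nlinarith [sq_nonneg ‖x‖]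
  · rw [min_eq_right h]
    nlinarith [sq_nonneg ‖ξ‖]

theorem IsLevyMeasure.eq_zero_of_levyExponent_eq_zero {d : ℕ}
    {ν : Measure (EuclideanSpace ℝ (Fin d))} (hν : IsLevyMeasure ν)
    (h : ∀ ξ, levyExponent ν ξ = 0) : ν = 0 := by
  have hae : ∀ ξ, ∀ᵐ x ∂ν, Real.cos (inner ℝ ξ x) = 1 := by
    intro ξ
    have h1 := (integral_eq_zero_iff_of_nonneg (μ := ν)
      (f := fun x => 1 - Real.cos (inner ℝ ξ x))
      (fun x => by simpa using Real.cos_le_one (inner ℝ ξ x))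
      (hν.integrable_one_sub_cos ξ)).1 (h ξ)
    filter_upwards [h1] with x hx
    simp only [Pi.zero_apply] at hx
    linarith
  -- Countably many frequencies suffice: for `n > |x i|` the argument `x i / (n + 1)` lies strictly
  -- within `2π` of 0, so cosine 1 forces `x i = 0`.
  have hall : ∀ᵐ x ∂ν, ∀ (i : Fin d) (n : ℕ),
      Real.cos (inner ℝ (EuclideanSpace.single i ((n : ℝ) + 1)⁻¹) x) = 1 := by
    rw [ae_all_iff]
    intro i
    rw [ae_all_iff]
    exact fun n => hae _
  have h0 : ∀ᵐ x ∂ν, x = 0 := by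
    filter_upwards [hall] with x hx
    ext i
    obtain ⟨n, hn⟩ := exists_nat_gt |x i|
    have h1 := hx i n
    have h2 : |((n : ℝ) + 1)⁻¹ * x i| < 2 * Real.pi := by
      have hn0 : (0 : ℝ) < n + 1 := by positivity
      rw [abs_mul, abs_of_pos (inv_pos.2 hn0), inv_mul_lt_iff₀ hn0]
      nlinarith [Real.pi_gt_three]
    rw [EuclideanSpace.inner_single_left] at h1
    simp only [conj_trivial] at h1
    have h3 := (Real.cos_eq_one_iff_of_lt_of_lt (abs_lt.1 h2).1 (abs_lt.1 h2).2).1 h1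
    have hn0 : ((n : ℝ) + 1)⁻¹ ≠ 0 := by positivity
    simpa [hn0] using h3
  rw [← Measure.measure_univ_eq_zero]
  refine le_antisymm ?_ zero_le
  calc ν univ ≤ ν ({0} ∪ {x | ¬ x = 0}) := measure_mono fun x _ => em (x = 0)
    _ ≤ ν {0} + ν {x | ¬ x = 0} := measure_union_le _ _
    _ = 0 := by rw [hν.1, ae_iff.1 h0, add_zero]

theorem levyExponent_nonneg {d : ℕ} (ν : Measure (EuclideanSpace ℝ (Fin d)))
    (ξ : EuclideanSpace ℝ (Fin d)) : 0 ≤ levyExponent ν ξ :=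
  integral_nonneg fun x => by simpa using Real.cos_le_one (inner ℝ ξ x)

theorem radialProfile_levyExponent_zero {d : ℕ} [NeZero d]
    (ν : Measure (EuclideanSpace ℝ (Fin d))) : radialProfile (levyExponent ν) 0 = 0 := by
  have : (EuclideanSpace.single 0 0 : EuclideanSpace ℝ (Fin d)) = 0 := by
    ext i
    simp
  simp [radialProfile, levyExponent, this]

theorem continuous_charFun_of_isFiniteMeasure {d : ℕ} (μ : Measure (EuclideanSpace ℝ (Fin d)))
    [IsFiniteMeasure μ] : Continuous (charFun μ) := by
  have : charFun μ = fun t => ∫ x, Complex.exp (inner ℝ x t * Complex.I) ∂μ :=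
    funext fun t => charFun_apply t
  rw [this]
  refine continuous_of_dominated (bound := fun _ => 1)
    (fun t => Continuous.aestronglyMeasurable (by fun_prop)) (fun t => ae_of_all _ fun x => ?_)
    (integrable_const _) (ae_of_all _ fun x => by fun_prop)
  rw [Complex.norm_exp_ofReal_mul_I]

namespace IsUnimodalLevySemigroup

variable {d : ℕ} {p : ℝ≥0 → Measure (EuclideanSpace ℝ (Fin d))}
  {ν : Measure (EuclideanSpace ℝ (Fin d))}

/-- Continuity and radiality of the exponent are thus read off from the law `p 1`, with no separate
study of `ν`. -/
theorem levyExponent_eq_neg_log (h : IsUnimodalLevySemigroup p ν)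
    (ξ : EuclideanSpace ℝ (Fin d)) : levyExponent ν ξ = -Real.log (charFun (p 1) ξ).re := by
  rw [h.charFun_eq, Complex.ofReal_re, Real.log_exp]
  simp

theorem continuous_levyExponent (h : IsUnimodalLevySemigroup p ν) :
    Continuous (levyExponent ν) := by
  have := h.isProbabilityMeasure 1
  rw [funext h.levyExponent_eq_neg_log]
  refine (Continuous.log (Complex.continuous_re.comp
    (continuous_charFun_of_isFiniteMeasure (p 1))) fun ξ => ?_).neg
  rw [Function.comp_apply, h.charFun_eq, Complex.ofReal_re]
  exact (Real.exp_pos _).ne'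

variable [NeZero d]

theorem levyExponent_eq_radialProfile (h : IsUnimodalLevySemigroup p ν)
    (ξ : EuclideanSpace ℝ (Fin d)) :
    levyExponent ν ξ = radialProfile (levyExponent ν) ‖ξ‖ := by
  rw [radialProfile, h.levyExponent_eq_neg_log, h.levyExponent_eq_neg_log,
    (h.unimodal 1).charFun_eq_of_norm_eq (η := EuclideanSpace.single 0 ‖ξ‖) (by simp)]

/-- A zero at 1 would spread by upper scaling to larger arguments and by lower scaling to smaller
ones, forcing `ν = 0`. -/
theorem radialProfile_one_pos (h : IsUnimodalLevySemigroup p ν) {αL cL αU CU : ℝ}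
    (hlo : WLSC (radialProfile (levyExponent ν)) αL 0 cL)
    (hup : WUSC (radialProfile (levyExponent ν)) αU 0 CU) :
    0 < radialProfile (levyExponent ν) 1 := by
  set ψ := radialProfile (levyExponent ν) with hψ
  have hnn : ∀ θ, 0 ≤ ψ θ := fun θ => levyExponent_nonneg ν _
  refine lt_of_le_of_ne (hnn 1) fun h1 => h.ne_zero ?_
  refine h.isLevyMeasure.eq_zero_of_levyExponent_eq_zero fun ξ => ?_
  rw [h.levyExponent_eq_radialProfile]
  refine le_antisymm ?_ (hnn _)
  change ψ ‖ξ‖ ≤ 0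
  rcases (norm_nonneg ξ).eq_or_lt with h0 | h0
  · rw [← h0, hψ, radialProfile_levyExponent_zero]
  · rcases le_total 1 ‖ξ‖ with hle | hle
    · have := hup.2.2 ‖ξ‖ 1 hle one_pos
      rwa [mul_one, ← h1, mul_zero] at this
    · have := hlo.2.2.2 ‖ξ‖⁻¹ ‖ξ‖ ((one_le_inv₀ h0).2 hle) h0
      rw [inv_mul_cancel₀ h0.ne', ← h1] at this
      have hc : 0 < cL * ‖ξ‖⁻¹ ^ αL := mul_pos hlo.2.1 (Real.rpow_pos_of_pos (inv_pos.2 h0) _)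
      exact nonpos_of_mul_nonpos_right this hc

theorem exists_mul_radialProfile_eq_one (h : IsUnimodalLevySemigroup p ν) {αL cL αU CU : ℝ}
    (hαL : 0 < αL) (hlo : WLSC (radialProfile (levyExponent ν)) αL 0 cL)
    (hup : WUSC (radialProfile (levyExponent ν)) αU 0 CU) {t : ℝ} (ht : 0 < t) :
    ∃ r, 0 < r ∧ t * radialProfile (levyExponent ν) r = 1 := by
  have h1 := h.radialProfile_one_pos hlo hup
  set ψ := radialProfile (levyExponent ν) with hψ
  have hcont : Continuous ψ := by
    refine h.continuous_levyExponent.comp ?_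
    have : (EuclideanSpace.single 0 : ℝ → EuclideanSpace ℝ (Fin d)) =
        fun u : ℝ => u • EuclideanSpace.single (0 : Fin d) (1 : ℝ) := by
      ext u i
      simp
    rw [this]
    fun_prop
  have h0 : ψ 0 = 0 := radialProfile_levyExponent_zero ν
  have hlim : Tendsto (fun b : ℝ => cL * b ^ αL * ψ 1) atTop atTop :=
    ((tendsto_rpow_atTop hαL).const_mul_atTop hlo.2.1).atTop_mul_const h1
  obtain ⟨b, hb, hb1⟩ := ((hlim.eventually_ge_atTop t⁻¹).and (eventually_ge_atTop 1)).exists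
  have hψb : t⁻¹ ≤ ψ b := by
    have := hlo.2.2.2 b 1 hb1 one_pos
    rw [mul_one] at this
    exact hb.trans this
  obtain ⟨r, hr, hrt⟩ := intermediate_value_Icc (by linarith : (0 : ℝ) ≤ b) hcont.continuousOn
    (⟨h0.le.trans (inv_pos.2 ht).le, hψb⟩ : t⁻¹ ∈ Icc (ψ 0) (ψ b))
  refine ⟨r, lt_of_le_of_ne hr.1 ?_, by rw [hrt, mul_inv_cancel₀ ht.ne']⟩
  rintro rfl
  rw [h0] at hrt
  exact (inv_pos.2 ht).ne hrt

end IsUnimodalLevySemigroup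

/-! ### Two-sided heat kernel estimate and conclusion -/

section Scaling

variable {φ : ℝ → ℝ} {α θ₀ c C t : ℝ}

theorem WLSC.const_mul (h : WLSC φ α θ₀ c) (ht : 0 ≤ t) : WLSC (fun θ => t * φ θ) α θ₀ c := by
  refine ⟨h.1, h.2.1, h.2.2.1, fun l θ hl hθ => ?_⟩
  calc c * l ^ α * (t * φ θ) = t * (c * l ^ α * φ θ) := by ring
    _ ≤ t * φ (l * θ) := mul_le_mul_of_nonneg_left (h.2.2.2 l θ hl hθ) ht

theorem WUSC.const_mul (h : WUSC φ α θ₀ C) (ht : 0 ≤ t) : WUSC (fun θ => t * φ θ) α θ₀ C := by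
  refine ⟨h.1, h.2.1, fun l θ hl hθ => ?_⟩
  calc t * φ (l * θ) ≤ t * (C * l ^ α * φ θ) := mul_le_mul_of_nonneg_left (h.2.2 l θ hl hθ) ht
    _ = C * l ^ α * (t * φ θ) := by ring

end Scaling

/-- Two-sided heat kernel estimate: at a scale `r` with `Φ r` of order one, the density is
comparable with `r ^ d` on a ball of radius of order `r⁻¹` and with `Φ (1 / |x|) / |x| ^ d`
outside of a smaller one. -/
theorem exists_density_estimate (d : ℕ) [NeZero d] {αL cL αU CU : ℝ} (hcL : 0 < cL)
    (hcL1 : cL ≤ 1) (hCU : 1 ≤ CU) (hαL : 0 < αL) (hαU : αU < 2) :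
    ∃ C K : ℝ, 1 ≤ C ∧ 1 ≤ K ∧
      ∀ (μ : Measure (EuclideanSpace ℝ (Fin d))) (Φ : ℝ → ℝ), IsProbabilityMeasure μ →
        IsIsotropicUnimodal μ → (∀ ξ, charFun μ ξ = (Real.exp (-Φ ‖ξ‖) : ℂ)) →
        (∀ θ, 0 ≤ Φ θ) → WLSC Φ αL 0 cL → WUSC Φ αU 0 CU → (∃ r, 0 < r ∧ 1 ≤ Φ r) →
        ∃ q, IsContinuousDensity μ q ∧ (∀ x y, ‖x‖ ≤ ‖y‖ → q y ≤ q x) ∧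
          ∀ r, 0 < r → 1 ≤ Φ r → Φ r ≤ 2 → ∀ x,
            (K / r ≤ ‖x‖ → Φ ‖x‖⁻¹ / ‖x‖ ^ d ≤ C * q x ∧ q x ≤ C * (Φ ‖x‖⁻¹ / ‖x‖ ^ d)) ∧
            (‖x‖ ≤ 2 * (K / r) → r ^ d ≤ C * q x ∧ q x ≤ C * r ^ d) := by
  obtain ⟨Cd, hCd0, hCd⟩ := exists_isContinuousDensity_le d hcL hαL
  obtain ⟨Cu, hCu0, hCu⟩ := exists_density_le d (αU := αU) hcL hCU hαL.le
  obtain ⟨a, ha0, ha⟩ := exists_le_density d hcL hCU hαL hαU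
  have hCU0 : 0 < CU := by linarith
  -- Chosen so that lower scaling from `1/R` to `r`, with `Φ r ≤ 2`, gives `Φ(1/R) ≤ cL` for every
  -- `R ≥ K/r`, as the lower bound requires.
  set K : ℝ := (2 / cL ^ 2) ^ αL⁻¹ with hK
  have h2c : 1 ≤ 2 / cL ^ 2 := by
    rw [one_le_div (by positivity)]
    nlinarith
  have hK1 : 1 ≤ K := Real.one_le_rpow h2c (inv_nonneg.2 hαL.le)
  have hK0 : 0 < K := by linarith
  have hKpow : K ^ αL = 2 / cL ^ 2 := by
    rw [hK, ← Real.rpow_mul (by linarith), inv_mul_cancel₀ hαL.ne', Real.rpow_one]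
  -- `b` is the lower near-diagonal constant
  set b : ℝ := CU * (2 * K) ^ αU * (2 * K) ^ d * a⁻¹ with hb
  have hb0 : 0 < b := by positivity
  refine ⟨1 + Cd + Cu + a⁻¹ + b, K, by have := inv_pos.2 ha0; linarith, hK1, ?_⟩
  set C : ℝ := 1 + Cd + Cu + a⁻¹ + b with hC
  have ha' := inv_pos.2 ha0
  intro μ Φ hprob hμ hchar hΦ hlo hup hex
  obtain ⟨q, hq, hmono, hdiag⟩ := hCd μ Φ hprob hμ hchar hΦ hlo hex
  refine ⟨q, hq, hmono, fun r hr hr1 hr2 => ?_⟩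
  have hR0 : 0 < K / r := by positivity
  have hsmall : ∀ R, K / r ≤ R → Φ R⁻¹ ≤ cL := by
    intro R hR
    have hRpos : 0 < R := hR0.trans_le hR
    have hKR : K ≤ r * R := by rwa [div_le_iff₀' hr] at hR
    have h1 := hlo.2.2.2 (r * R) R⁻¹ (hK1.trans hKR) (inv_pos.2 hRpos)
    rw [mul_inv_cancel_right₀ hRpos.ne'] at h1
    have h2 : 2 / cL ^ 2 ≤ (r * R) ^ αL := by
      rw [← hKpow]
      exact Real.rpow_le_rpow hK0.le hKR hαL.le
    have h3 : cL * (2 / cL ^ 2) * Φ R⁻¹ ≤ 2 :=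
      le_trans (mul_le_mul_of_nonneg_right (mul_le_mul_of_nonneg_left h2 hcL.le) (hΦ _))
        (h1.trans hr2)
    have h4 : cL * (2 / cL ^ 2) * Φ R⁻¹ = 2 * Φ R⁻¹ / cL := by field_simp
    rw [h4, div_le_iff₀ hcL] at h3
    linarith
  have hlow : ∀ x, K / r ≤ ‖x‖ → Φ ‖x‖⁻¹ / ‖x‖ ^ d ≤ a⁻¹ * q x := by
    intro x hx
    have h1 := ha μ Φ q hprob hchar hΦ hlo hup hq hmono x (norm_pos_iff.1 (hR0.trans_le hx))
      (hsmall _ hx)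
    rw [le_inv_mul_iff₀ ha0]
    rwa [mul_div_assoc] at h1
  intro x
  have hqx := hq.2.1 x
  refine ⟨fun hx => ⟨(hlow x hx).trans (by gcongr; linarith), ?_⟩, fun hx => ⟨?_, ?_⟩⟩
  · have h1 := hCu μ Φ q hprob hchar hΦ hlo hup hq hmono x (norm_pos_iff.1 (hR0.trans_le hx))
    rw [mul_div_assoc] at h1
    have h2 : 0 ≤ Φ ‖x‖⁻¹ / ‖x‖ ^ d := div_nonneg (hΦ _) (by positivity)
    exact h1.trans (by gcongr; linarith)
  -- Near the origin `q` is at least its value at radius `2K/r`, where the off-diagonal lower bound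
  -- applies and is of order `r ^ d`.
  · set y : EuclideanSpace ℝ (Fin d) := EuclideanSpace.single 0 (2 * (K / r)) with hy
    have hyn : ‖y‖ = 2 * K / r := by
      rw [hy, PiLp.norm_single, Real.norm_of_nonneg (by positivity), mul_div_assoc]
    have h1 := hlow y (by rw [hyn]; gcongr; linarith)
    have h2 : q y ≤ q x := hmono x y (by rw [hyn, mul_div_assoc]; exact hx)
    have h3 : 1 ≤ CU * (2 * K) ^ αU * Φ ‖y‖⁻¹ := by
      have h4 := hup.map_mul_inv_le (l := 2 * K) (R := 2 * K / r) (by linarith) (by positivity)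
      rw [show 2 * K * (2 * K / r)⁻¹ = r by field_simp] at h4
      rw [hyn]
      exact hr1.trans h4
    calc r ^ d ≤ CU * (2 * K) ^ αU * Φ ‖y‖⁻¹ * r ^ d := le_mul_of_one_le_left (by positivity) h3
      _ = CU * (2 * K) ^ αU * (2 * K) ^ d * (Φ ‖y‖⁻¹ / ‖y‖ ^ d) := by
          rw [hyn, div_pow]
          field_simp
      _ ≤ CU * (2 * K) ^ αU * (2 * K) ^ d * (a⁻¹ * q y) := by gcongr
      _ = b * q y := by rw [hb]; ring
      _ ≤ b * q x := by gcongr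
      _ ≤ C * q x := by gcongr; linarith
  · exact (hdiag r hr hr1 x).trans (by gcongr; linarith)

theorem comparableWith_of_le {C a b : ℝ} (hC : 0 < C) (ha : 0 ≤ a) (hb : 0 ≤ b) (h1 : a ≤ C * b)
    (h2 : b ≤ C * a) : ComparableWith C a b :=
  ⟨ha, hb, by rwa [inv_mul_le_iff₀ hC], h2⟩

theorem mainTheorem5 (d : ℕ) [NeZero d] (αL cL αU CU : ℝ)
    (hαL : 0 < αL ∧ αL < 2) (hαU : 0 < αU ∧ αU < 2) :
    ∃ C : ℝ, 0 < C ∧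
      ∀ (p : ℝ≥0 → Measure (EuclideanSpace ℝ (Fin d))) (ν : Measure (EuclideanSpace ℝ (Fin d))),
        IsUnimodalLevySemigroup p ν →
        WLSC (radialProfile (levyExponent ν)) αL 0 cL →
        WUSC (radialProfile (levyExponent ν)) αU 0 CU →
        ∃ q : ℝ≥0 → EuclideanSpace ℝ (Fin d) → ℝ,
          (∀ t, 0 < t → IsContinuousDensity (p t) (q t)) ∧
          (∀ t, 0 < t → ∀ x, ComparableWith C (q t ((2 : ℝ) • x)) (q t x)) ∧
          (∀ t, 0 < t → ∀ x, ComparableWith C (q (2 * t) x) (q t x)) := by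
  -- The scaling hypotheses include these inequalities, so otherwise the claim is vacuous.
  by_cases hconst : 0 < cL ∧ cL ≤ 1 ∧ 1 ≤ CU
  swap
  · exact ⟨1, one_pos, fun p ν _ hlo hup => absurd ⟨hlo.2.1, hlo.2.2.1, hup.2.1⟩ hconst⟩
  obtain ⟨hcL, hcL1, hCU⟩ := hconst
  obtain ⟨C, K, hC, hK, hest⟩ := exists_density_estimate d hcL hcL1 hCU hαL.1 hαU.2
  have hC0 : 0 < C := by linarith
  set D : ℝ := CU * 2 ^ αU * 2 ^ d with hD
  have hD1 : 1 ≤ D := by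
    have h1 : (1 : ℝ) ≤ 2 ^ αU := Real.one_le_rpow one_le_two hαU.1.le
    have h2 : (1 : ℝ) ≤ 2 ^ d := one_le_pow₀ one_le_two
    exact one_le_mul_of_one_le_of_one_le (one_le_mul_of_one_le_of_one_le hCU h1) h2
  have hCC : 1 ≤ C * C := one_le_mul_of_one_le_of_one_le hC hC
  have hB0 : 0 < 2 * D * (C * C) := by positivity
  refine ⟨2 * D * (C * C), hB0, ?_⟩
  intro p ν h hlo hup
  set ψ := radialProfile (levyExponent ν) with hψ
  have hψ0 : ∀ θ, 0 ≤ ψ θ := fun θ => levyExponent_nonneg ν _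
  have hr : ∀ t : ℝ≥0, 0 < t → ∃ r, 0 < r ∧ (t : ℝ) * ψ r = 1 := fun t ht =>
    h.exists_mul_radialProfile_eq_one hαL.1 hlo hup (NNReal.coe_pos.2 ht)
  have hq : ∀ t : ℝ≥0, ∃ q : EuclideanSpace ℝ (Fin d) → ℝ, 0 < t →
      IsContinuousDensity (p t) q ∧ (∀ x y, ‖x‖ ≤ ‖y‖ → q y ≤ q x) ∧
        ∀ r, 0 < r → 1 ≤ (t : ℝ) * ψ r → (t : ℝ) * ψ r ≤ 2 → ∀ x,
          (K / r ≤ ‖x‖ → (t : ℝ) * ψ ‖x‖⁻¹ / ‖x‖ ^ d ≤ C * q x ∧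
            q x ≤ C * ((t : ℝ) * ψ ‖x‖⁻¹ / ‖x‖ ^ d)) ∧
          (‖x‖ ≤ 2 * (K / r) → r ^ d ≤ C * q x ∧ q x ≤ C * r ^ d) := by
    intro t
    by_cases ht : 0 < t
    swap
    · exact ⟨0, fun h => absurd h ht⟩
    obtain ⟨r, hr0, hr1⟩ := hr t ht
    obtain ⟨q, hq⟩ := hest (p t) (fun θ => t * ψ θ) (h.isProbabilityMeasure t) (h.unimodal t)
      (fun ξ => by rw [h.charFun_eq, h.levyExponent_eq_radialProfile])
      (fun θ => mul_nonneg t.2 (hψ0 θ)) (hlo.const_mul t.2) (hup.const_mul t.2) ⟨r, hr0, hr1.ge⟩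
    exact ⟨q, fun _ => hq⟩
  choose q hq using hq
  refine ⟨q, fun t ht => (hq t ht).1, fun t ht x => ?_, fun t ht x => ?_⟩
  · obtain ⟨hdens, hmono, hest⟩ := hq t ht
    obtain ⟨r, hr0, hr1⟩ := hr t ht
    have hest := hest r hr0 hr1.ge (by rw [hr1]; exact one_le_two)
    have hn : ‖(2 : ℝ) • x‖ = 2 * ‖x‖ := by simp [norm_smul]
    have hq0 := hdens.2.1 x
    have hq2 := hdens.2.1 ((2 : ℝ) • x)
    refine comparableWith_of_le hB0 hq2 hq0 ?_ ?_
    · have h1 : q t ((2 : ℝ) • x) ≤ q t x :=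
        hmono _ _ (by rw [hn]; linarith [norm_nonneg x])
      exact h1.trans (le_mul_of_one_le_left hq0 (by nlinarith))
    -- Both `x` and `2x` lie in the outer region, or both in the ball of radius `2K/r`; the overlap
    -- of the regions serves this purpose.
    · rcases le_total (K / r) ‖x‖ with hx | hx
      · have hx0 : 0 < ‖x‖ := lt_of_lt_of_le (by positivity) hx
        have h1 := ((hest x).1 hx).2
        have h2 := ((hest ((2 : ℝ) • x)).1 (by rw [hn]; linarith)).1
        have h3 : ψ ‖x‖⁻¹ ≤ CU * 2 ^ αU * ψ (2 * ‖x‖)⁻¹ := by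
          have := hup.map_mul_inv_le one_le_two (by positivity : 0 < 2 * ‖x‖)
          rwa [show 2 * (2 * ‖x‖)⁻¹ = ‖x‖⁻¹ by field_simp] at this
        rw [hn] at h2
        calc q t x ≤ C * (t * ψ ‖x‖⁻¹ / ‖x‖ ^ d) := h1
          _ ≤ C * (t * (CU * 2 ^ αU * ψ (2 * ‖x‖)⁻¹) / ‖x‖ ^ d) := by gcongr
          _ = D * C * (t * ψ (2 * ‖x‖)⁻¹ / (2 * ‖x‖) ^ d) := by
              rw [hD, mul_pow]
              field_simp
          _ ≤ D * C * (C * q t ((2 : ℝ) • x)) := by gcongr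
          _ = D * (C * C) * q t ((2 : ℝ) • x) := by ring
          _ ≤ 2 * D * (C * C) * q t ((2 : ℝ) • x) := by gcongr; linarith
      · have hKr : 0 < K / r := by positivity
        have h1 := ((hest x).2 (by linarith)).2
        have h2 := ((hest ((2 : ℝ) • x)).2 (by rw [hn]; linarith)).1
        calc q t x ≤ C * r ^ d := h1
          _ ≤ C * (C * q t ((2 : ℝ) • x)) := by gcongr
          _ = 1 * (C * C) * q t ((2 : ℝ) • x) := by ring
          _ ≤ 2 * D * (C * C) * q t ((2 : ℝ) • x) := by gcongr; linarith
  · have ht2 : 0 < 2 * t := by positivity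
    obtain ⟨hdens, -, hest⟩ := hq t ht
    obtain ⟨hdens2, -, hest2⟩ := hq (2 * t) ht2
    obtain ⟨r, hr0, hr1⟩ := hr t ht
    have hcast : ((2 * t : ℝ≥0) : ℝ) = 2 * t := by push_cast; ring
    -- The window `1 ≤ Φ r ≤ 2` admits the same `r` for `t` and `2t`, so the two estimates share
    -- their regions.
    have hr2 : ((2 * t : ℝ≥0) : ℝ) * ψ r = 2 := by rw [hcast, mul_assoc, hr1, mul_one]
    have hest := hest r hr0 hr1.ge (by rw [hr1]; exact one_le_two) x
    have hest2 := hest2 r hr0 (by rw [hr2]; exact one_le_two) hr2.le x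
    rw [hcast] at hest2
    have hq0 := hdens.2.1 x
    have hq2 := hdens2.2.1 x
    have hle : 2 * (C * C) ≤ 2 * D * (C * C) := by nlinarith
    rcases le_total (K / r) ‖x‖ with hx | hx
    · obtain ⟨h1, h1'⟩ := hest.1 hx
      obtain ⟨h2, h2'⟩ := hest2.1 hx
      have hE : 2 * (t : ℝ) * ψ ‖x‖⁻¹ / ‖x‖ ^ d = 2 * (t * ψ ‖x‖⁻¹ / ‖x‖ ^ d) := by ring
      have hE0 : 0 ≤ (t : ℝ) * ψ ‖x‖⁻¹ / ‖x‖ ^ d :=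
        div_nonneg (mul_nonneg t.2 (hψ0 _)) (by positivity)
      rw [hE] at h2 h2'
      refine comparableWith_of_le hB0 hq2 hq0 ?_ ?_
      · calc _ ≤ C * (2 * (t * ψ ‖x‖⁻¹ / ‖x‖ ^ d)) := h2'
          _ ≤ C * (2 * (C * q t x)) := by gcongr
          _ = 2 * (C * C) * q t x := by ring
          _ ≤ _ := mul_le_mul_of_nonneg_right hle hq0
      · calc _ ≤ C * (t * ψ ‖x‖⁻¹ / ‖x‖ ^ d) := h1'
          _ ≤ C * (C * q (2 * t) x) := by gcongr; linarith
          _ = (C * C) * q (2 * t) x := by ring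
          _ ≤ _ := mul_le_mul_of_nonneg_right (by linarith) (by assumption)
    · have hKr : 0 < K / r := by positivity
      obtain ⟨h1, h1'⟩ := hest.2 (by linarith)
      obtain ⟨h2, h2'⟩ := hest2.2 (by linarith)
      refine comparableWith_of_le hB0 hq2 hq0 ?_ ?_
      · calc _ ≤ C * r ^ d := h2'
          _ ≤ C * (C * q t x) := by gcongr
          _ = (C * C) * q t x := by ring
          _ ≤ _ := mul_le_mul_of_nonneg_right (by linarith) (by assumption)
      · calc _ ≤ C * r ^ d := h1'
          _ ≤ C * (C * q (2 * t) x) := by gcongr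
          _ = (C * C) * q (2 * t) x := by ring
          _ ≤ _ := mul_le_mul_of_nonneg_right (by linarith) (by assumption)
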